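/- For an integer $d\ge 1$ and $r\in\mathbb{R}$ let $G_d(x,0)$ be the cumulative distribution function of the central chi-squared distribution with $d$ degrees of freedom (the law of $\sum_{i=1}^d Z_i^2$ with $Z_1,\dots,Z_d$ i.i.d. $N(0,1)$), and let $G_d(x,r^2)$ be that of the noncentral chi-squared distribution with $d$ degrees of freedom and noncentrality parameter $r^2$ (the law of $\sum_{i=1}^d (Z_i+m_i)^2$ for any $m\in\mathbb{R}^d$ with $\sum_i m_i^2=r^2$). Let $\Phi$ be the standard normal distribution function. For $\alpha\in(0,1)$ let $T_{d\alpha}$ and $z_\alpha$ be the $(1-\alpha)$-quantiles of the central chi-squared distribution with $d$ degrees of freedom and of $N(0,1)$, respectively. Then, as $d\to\infty$: 1. $$\sup_{x\in\mathbb{R}}\left|G_d(x,0)-\Phi\left(\frac{x-d}{\sqrt{2d}}\right)\right|\to 0;$$ 2. $$\sup_{x,r\in\mathbb{R}}\left|G_d(x,r^2)-\Phi\left(\frac{x-d-r^2}{\sqrt{2d+4r^2}}\right)\right|\to 0;$$ 3. for every fixed $\alpha\in(0,1)$, $$\sup_{r\in\mathbb{R}}\left|G_d(T_{d\alpha},r^2)-\Phi\left(\frac{\sqrt{2d}}{\sqrt{2d+4r^2}}\,z_\alpha-\frac{r^2}{\sqrt{2d+4r^2}}\right)\right|\to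 0.$$ -/

import Mathlib

open MeasureTheory ProbabilityTheory Filter Topology

/-- The law of `d` independent standard normal variables. -/
noncomputable def stdNormalVec (d : ℕ) : Measure (Fin d → ℝ) :=
  Measure.pi fun _ => gaussianReal 0 1

/-- The central chi-squared distribution with `d` degrees of freedom: the law of
`∑ i, Z i ^ 2` for independent standard normal variables `Z i`, `i < d`. -/
noncomputable def centralChiSq (d : ℕ) : Measure ℝ :=
  (stdNormalVec d).map fun z => ∑ i, z i ^ 2

/-- The noncentral chi-squared distribution with `d ≥ 1` degrees of freedom and noncentrality
parameter `lam ≥ 0`: the law of `∑ i, (Z i + m i) ^ 2`, where the `Z i` are independent standard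
normal and `∑ i, m i ^ 2 = lam`. The law depends on the shift `m` through `lam` only, see
`noncentralChiSq_eq_map`; here every coordinate is shifted by the same amount `√(lam / d)`. -/
noncomputable def noncentralChiSq (d : ℕ) (lam : ℝ) : Measure ℝ :=
  (stdNormalVec d).map fun z => ∑ i, (z i + √(lam / d)) ^ 2

/-- The standard normal distribution function. -/
noncomputable def stdNormalCDF (x : ℝ) : ℝ := cdf (gaussianReal 0 1) x

/-- The `p`-quantile of a probability measure on the line, `0 < p < 1`: the least `x` with
`p ≤ F x`, where `F` is the distribution function (see `isLeast_quantile`). -/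
noncomputable def quantile (P : Measure ℝ) (p : ℝ) : ℝ := sInf {x : ℝ | p ≤ cdf P x}

/-! ### The definitions are meaningful -/

instance (d : ℕ) : IsProbabilityMeasure (stdNormalVec d) := by
  unfold stdNormalVec; infer_instance

instance (d : ℕ) : IsProbabilityMeasure (centralChiSq d) :=
  Measure.isProbabilityMeasure_map (Measurable.aemeasurable (by fun_prop))

instance (d : ℕ) (lam : ℝ) : IsProbabilityMeasure (noncentralChiSq d lam) :=
  Measure.isProbabilityMeasure_map (Measurable.aemeasurable (by fun_prop))

theorem noncentralChiSq_zero (d : ℕ) : noncentralChiSq d 0 = centralChiSq d := by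
  simp [noncentralChiSq, centralChiSq]

/-- Shifts of equal Euclidean norm give the same law. -/
theorem map_shift_eq_of_sum_sq_eq (d : ℕ) (m m' : Fin d → ℝ)
    (h : ∑ i, m i ^ 2 = ∑ i, m' i ^ 2) :
    ((stdNormalVec d).map fun z => ∑ i, (z i + m i) ^ 2) =
      (stdNormalVec d).map fun z => ∑ i, (z i + m' i) ^ 2 := by
  have key : ∀ a : Fin d → ℝ, ((stdNormalVec d).map fun z => ∑ i, (z i + a i) ^ 2) =
      (stdGaussian (EuclideanSpace ℝ (Fin d))).map fun w => ‖w + WithLp.toLp 2 a‖ ^ 2 := by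
    intro a
    rw [← map_pi_eq_stdGaussian, Measure.map_map (by fun_prop) (by fun_prop)]
    congr 1
    funext z
    simp [EuclideanSpace.norm_sq_eq]
  have hn : ‖(WithLp.toLp 2 m : EuclideanSpace ℝ (Fin d))‖ =
      ‖(WithLp.toLp 2 m' : EuclideanSpace ℝ (Fin d))‖ := by
    simp [EuclideanSpace.norm_eq, h]
  rw [key, key]
  set v : EuclideanSpace ℝ (Fin d) := WithLp.toLp 2 m
  set w : EuclideanSpace ℝ (Fin d) := WithLp.toLp 2 m'
  have hU := Submodule.reflection_sub hn
  set U := (Submodule.span ℝ {v - w})ᗮ.reflection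
  conv_rhs => rw [← stdGaussian_map U]
  rw [Measure.map_map (by fun_prop) U.continuous.measurable]
  congr 1
  funext z
  simp only [Function.comp]
  rw [← hU, ← map_add, LinearIsometryEquiv.norm_map]

/-- Any shift `m` with `∑ i, m i ^ 2 = lam` may be used for the noncentral chi-squared law. -/
theorem noncentralChiSq_eq_map (d : ℕ) (lam : ℝ) (hd : 0 < d) (m : Fin d → ℝ)
    (hm : ∑ i, m i ^ 2 = lam) :
    noncentralChiSq d lam = (stdNormalVec d).map fun z => ∑ i, (z i + m i) ^ 2 := by
  refine map_shift_eq_of_sum_sq_eq d (fun _ => √(lam / d)) m ?_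
  have h0 : 0 ≤ lam := hm ▸ Finset.sum_nonneg fun i _ => sq_nonneg (m i)
  have hd' : (d : ℝ) ≠ 0 := by positivity
  rw [hm]
  simp only [Finset.sum_const, Finset.card_univ, Fintype.card_fin, nsmul_eq_mul]
  rw [Real.sq_sqrt (by positivity)]
  field_simp

theorem isLeast_quantile (P : Measure ℝ) (p : ℝ) (h0 : 0 < p) (h1 : p < 1) :
    IsLeast {x : ℝ | p ≤ cdf P x} (quantile P p) := by
  have hne : {x : ℝ | p ≤ cdf P x}.Nonempty :=
    (((tendsto_cdf_atTop P).eventually (lt_mem_nhds h1)).exists).imp fun _ h => le_of_lt h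
  obtain ⟨b, hb⟩ := ((tendsto_cdf_atBot P).eventually (gt_mem_nhds h0)).exists
  have hbdd : BddBelow {x : ℝ | p ≤ cdf P x} := by
    refine ⟨b, fun x hx => ?_⟩
    by_contra hlt
    have := monotone_cdf P (le_of_lt (not_le.mp hlt))
    have hx' : p ≤ cdf P x := hx
    linarith
  refine ⟨?_, fun x hx => csInf_le hbdd hx⟩
  have hright : Tendsto (cdf P) (𝓝[>] (quantile P p)) (𝓝 (cdf P (quantile P p))) :=
    ((cdf P).right_continuous _).tendsto.mono_left (nhdsWithin_mono _ Set.Ioi_subset_Ici_self)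
  refine ge_of_tendsto hright ?_
  filter_upwards [self_mem_nhdsWithin] with y hy
  obtain ⟨x, hx, hxy⟩ := exists_lt_of_csInf_lt hne hy
  exact le_trans hx (monotone_cdf P hxy.le)

/-! ### Moments of the standard normal distribution -/

/-! Uniform convergence follows from convergence along every choice of parameters `r d`, `x d`
(`tendstoUniformly_zero_of_forall_tendsto`), so a central limit theorem for triangular arrays
suffices. With equal shifts, the standardized noncentral chi-squared variable is `d^(-1/2)` times a
sum of `d` i.i.d. terms `a (Z² - 1) / √2 + b Z`, where `a² + b² = 1`; all dependence on `r` sits in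
the point `(a, b)` of the unit circle. These terms have mean 0, variance 1 and third absolute
moments bounded over the circle, so each characteristic function is `1 - t²/(2d) + O(d^(-3/2))`
uniformly in `r`, and its `d`-th power tends to `exp(-t²/2)`. Lévy's theorem and Pólya's theorem
then give the second claim; `r = 0` is the first. For the third, the second is evaluated at the
chi-squared quantile, whose standardization tends to the normal one; `Φ` is 1-Lipschitz and `√(2d) /
√(2d + 4r²) ≤ 1`, so the replacement error is uniform in `r`. -/

theorem iteratedDeriv_exp_sq_half :
    iteratedDeriv 1 (fun t : ℝ => Real.exp (t ^ 2 / 2)) 0 = 0 ∧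
    iteratedDeriv 2 (fun t : ℝ => Real.exp (t ^ 2 / 2)) 0 = 1 ∧
    iteratedDeriv 3 (fun t : ℝ => Real.exp (t ^ 2 / 2)) 0 = 0 ∧
    iteratedDeriv 4 (fun t : ℝ => Real.exp (t ^ 2 / 2)) 0 = 3 := by
  have h : ∀ (p : ℝ → ℝ) (p' t : ℝ), HasDerivAt p p' t →
      HasDerivAt (fun t => p t * Real.exp (t ^ 2 / 2))
        ((p' + t * p t) * Real.exp (t ^ 2 / 2)) t := by
    intro p p' t hp
    have he : HasDerivAt (fun t : ℝ => t ^ 2 / 2) t t := by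
      convert! (hasDerivAt_pow 2 t).div_const 2 using 1
      simp
    convert! hp.mul he.exp using 1
    ring
  have d1 : deriv (fun t : ℝ => Real.exp (t ^ 2 / 2)) = fun t => t * Real.exp (t ^ 2 / 2) := by
    funext t
    have := (h (fun _ => 1) 0 t (hasDerivAt_const _ _)).deriv
    simpa using this
  have d2 : deriv (fun t : ℝ => t * Real.exp (t ^ 2 / 2)) =
      fun t => (1 + t ^ 2) * Real.exp (t ^ 2 / 2) := by
    funext t
    rw [(h (fun t => t) 1 t (hasDerivAt_id t)).deriv]
    ring
  have d3 : deriv (fun t : ℝ => (1 + t ^ 2) * Real.exp (t ^ 2 / 2)) =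
      fun t => (3 * t + t ^ 3) * Real.exp (t ^ 2 / 2) := by
    funext t
    rw [(h (fun t => 1 + t ^ 2) (2 * t) t
      (by simpa using (hasDerivAt_pow 2 t).const_add 1)).deriv]
    ring
  have d4 : deriv (fun t : ℝ => (3 * t + t ^ 3) * Real.exp (t ^ 2 / 2)) =
      fun t => (3 + 6 * t ^ 2 + t ^ 4) * Real.exp (t ^ 2 / 2) := by
    funext t
    rw [(h (fun t => 3 * t + t ^ 3) (3 + 3 * t ^ 2) t
      (by simpa using ((hasDerivAt_id t).const_mul 3).fun_add (hasDerivAt_pow 3 t))).deriv]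
    ring
  simp [iteratedDeriv_succ', d1, d2, d3, d4]

theorem integral_pow_stdNormal (n : ℕ) :
    ∫ z, z ^ n ∂gaussianReal 0 1 = iteratedDeriv n (fun t : ℝ => Real.exp (t ^ 2 / 2)) 0 := by
  have h := iteratedDeriv_mgf_zero (X := id) (μ := gaussianReal 0 1)
    (by simp [integrableExpSet_id_gaussianReal]) n
  rw [mgf_id_gaussianReal] at h
  simpa using h.symm

theorem integrable_pow_stdNormal (n : ℕ) : Integrable (fun z => z ^ n) (gaussianReal 0 1) := by
  rcases eq_or_ne n 0 with rfl | hn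
  · simp
  have h := (memLp_id_gaussianReal (μ := 0) (v := 1) (n : NNReal)).integrable_norm_pow hn
  refine h.mono (by fun_prop) (ae_of_all _ fun z => ?_)
  simp

/-! ### Taylor expansion of characteristic functions with a third-moment remainder -/

/-- For `|x| ≤ 1` the exponential remainder is at most `e |x|³`; for `|x| ≥ 1` every term is
dominated by a multiple of `|x|³`, in total `7/2`. The constant 4 covers both. -/
theorem norm_exp_mul_I_sub_taylor_two_le (x : ℝ) :
    ‖Complex.exp (x * Complex.I) - (1 + x * Complex.I - x ^ 2 / 2)‖ ≤ 4 * |x| ^ 3 := by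
  rcases le_total |x| 1 with hx | hx
  · have h := Complex.norm_exp_sub_sum_le_norm_mul_exp (x * Complex.I) 3
    have e : ∑ m ∈ Finset.range 3, (x * Complex.I) ^ m / (m.factorial : ℂ) =
        1 + x * Complex.I - x ^ 2 / 2 := by
      simp [Finset.sum_range_succ, mul_pow, Nat.factorial]
      ring
    rw [e] at h
    refine h.trans ?_
    simp only [norm_mul, Complex.norm_real, Complex.norm_I, mul_one, Real.norm_eq_abs]
    have h1 : Real.exp |x| ≤ 4 :=
      (Real.exp_le_exp.2 hx).trans (Real.exp_one_lt_d9.le.trans (by norm_num))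
    rw [mul_comm]
    gcongr
  · have h1 : ‖Complex.exp (x * Complex.I)‖ = 1 := Complex.norm_exp_ofReal_mul_I x
    have h2 : ‖(1 + x * Complex.I - x ^ 2 / 2 : ℂ)‖ ≤ 1 + |x| + |x| ^ 2 / 2 := by
      refine (norm_sub_le _ _).trans (add_le_add ((norm_add_le _ _).trans ?_) ?_) <;> simp
    refine (norm_sub_le _ _).trans ?_
    rw [h1]
    nlinarith [pow_le_pow_left₀ zero_le_one hx 2, pow_le_pow_left₀ zero_le_one hx 3,
      mul_le_mul_of_nonneg_left hx (sq_nonneg |x|)]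

/-- The majorant `B` stands in for `|X|³` so that one bound can serve a whole family of variables.
-/
theorem norm_integral_exp_sub_le {Ω : Type*} [MeasurableSpace Ω] {P : Measure Ω}
    [IsProbabilityMeasure P] {X B : Ω → ℝ} (hX : AEStronglyMeasurable X P) (hi : Integrable X P)
    (hi2 : Integrable (fun ω => X ω ^ 2) P) (hB : Integrable B P) (h3 : ∀ ω, |X ω| ^ 3 ≤ B ω)
    (h0 : ∫ ω, X ω ∂P = 0) (h1 : ∫ ω, X ω ^ 2 ∂P = 1) (s : ℝ) :
    ‖∫ ω, Complex.exp ((s * X ω : ℝ) * Complex.I) ∂P - (1 - s ^ 2 / 2)‖ ≤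
      4 * |s| ^ 3 * ∫ ω, B ω ∂P := by
  have hexp : Integrable (fun ω => Complex.exp ((s * X ω : ℝ) * Complex.I)) P := by
    refine Integrable.mono' (integrable_const (1 : ℝ)) ?_
      (ae_of_all _ fun ω => (Complex.norm_exp_ofReal_mul_I _).le)
    exact (Continuous.comp_aestronglyMeasurable (g := fun x : ℝ =>
      Complex.exp ((s * x : ℝ) * Complex.I)) (by fun_prop) hX)
  have hlin : Integrable (fun ω => ((s * X ω : ℝ) : ℂ) * Complex.I) P :=
    (hi.const_mul s).ofReal.mul_const _
  have hsq : Integrable (fun ω => (((s ^ 2 / 2 * X ω ^ 2 : ℝ)) : ℂ)) P :=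
    (hi2.const_mul (s ^ 2 / 2)).ofReal
  have hT : ∫ ω, (1 + ((s * X ω : ℝ) : ℂ) * Complex.I - ((s ^ 2 / 2 * X ω ^ 2 : ℝ) : ℂ)) ∂P =
      1 - s ^ 2 / 2 := by
    rw [integral_sub ((integrable_const 1).fun_add hlin) hsq,
      integral_add (integrable_const 1) hlin, integral_mul_const, integral_complex_ofReal,
      integral_complex_ofReal, integral_const_mul, integral_const_mul, h0, h1]
    simp
  rw [← hT, ← integral_sub hexp (g := fun ω => 1 + ((s * X ω : ℝ) : ℂ) * Complex.I -
      ((s ^ 2 / 2 * X ω ^ 2 : ℝ) : ℂ)) (((integrable_const 1).fun_add hlin).sub hsq),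
    ← integral_const_mul]
  refine norm_integral_le_of_norm_le (hB.const_mul _) (ae_of_all _ fun ω => ?_)
  have h := norm_exp_mul_I_sub_taylor_two_le (s * X ω)
  have e : (((s * X ω : ℝ) : ℂ)) ^ 2 / 2 = ((s ^ 2 / 2 * X ω ^ 2 : ℝ) : ℂ) := by
    push_cast; ring
  rw [e] at h
  refine h.trans ?_
  rw [abs_mul, mul_pow, ← mul_assoc]
  exact mul_le_mul_of_nonneg_left (h3 ω) (by positivity)

/-! ### One standardized coordinate of the noncentral chi-squared law -/

/-- A standardized summand: `a (z² - 1) / √2 + b z` with `a² + b² = 1`. -/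
noncomputable def chiSqSummand (a b z : ℝ) : ℝ := a * (z ^ 2 - 1) / √2 + b * z

theorem continuous_chiSqSummand (a b : ℝ) : Continuous (chiSqSummand a b) := by
  unfold chiSqSummand; fun_prop

/-- The powers `z ^ 1` and `z ^ 0` are kept so that every term is a multiple of a moment integrand.
-/
theorem chiSqSummand_eq (a b z : ℝ) :
    chiSqSummand a b z = a / √2 * z ^ 2 + b * z ^ 1 - a / √2 * z ^ 0 := by
  unfold chiSqSummand; ring

theorem chiSqSummand_sq (a b z : ℝ) :
    chiSqSummand a b z ^ 2 = a ^ 2 / 2 * z ^ 4 + 2 * (a / √2) * b * z ^ 3 +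
      (b ^ 2 - a ^ 2) * z ^ 2 + -(2 * (a / √2) * b) * z ^ 1 + a ^ 2 / 2 * z ^ 0 := by
  have h : (a / √2) ^ 2 = a ^ 2 / 2 := by rw [div_pow, Real.sq_sqrt (by norm_num)]
  rw [chiSqSummand_eq]
  linear_combination (z ^ 2 - 1) ^ 2 * h

theorem integrable_chiSqSummand (a b : ℝ) :
    Integrable (chiSqSummand a b) (gaussianReal 0 1) := by
  have hi := integrable_pow_stdNormal
  rw [funext (chiSqSummand_eq a b)]
  exact (((hi 2).const_mul _).fun_add ((hi 1).const_mul _)).sub ((hi 0).const_mul _)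

theorem integral_chiSqSummand (a b : ℝ) :
    ∫ z, chiSqSummand a b z ∂gaussianReal 0 1 = 0 := by
  have hi := integrable_pow_stdNormal
  obtain ⟨m1, m2, m3, m4⟩ := iteratedDeriv_exp_sq_half
  simp_rw [chiSqSummand_eq]
  rw [integral_sub (((hi 2).const_mul _).fun_add ((hi 1).const_mul _)) ((hi 0).const_mul _),
    integral_add ((hi 2).const_mul _) ((hi 1).const_mul _)]
  simp only [integral_const_mul]
  rw [integral_pow_stdNormal 2, integral_pow_stdNormal 1, m1, m2]
  simp

theorem integrable_chiSqSummand_sq (a b : ℝ) :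
    Integrable (fun z => chiSqSummand a b z ^ 2) (gaussianReal 0 1) := by
  have hi := integrable_pow_stdNormal
  rw [funext (chiSqSummand_sq a b)]
  exact (((((hi 4).const_mul _).fun_add ((hi 3).const_mul _)).fun_add ((hi 2).const_mul _)).fun_add
    ((hi 1).const_mul _)).fun_add ((hi 0).const_mul _)

theorem integral_chiSqSummand_sq (a b : ℝ) (hab : a ^ 2 + b ^ 2 = 1) :
    ∫ z, chiSqSummand a b z ^ 2 ∂gaussianReal 0 1 = 1 := by
  have hi := integrable_pow_stdNormal
  obtain ⟨m1, m2, m3, m4⟩ := iteratedDeriv_exp_sq_half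
  simp_rw [chiSqSummand_sq]
  rw [integral_add (((((hi 4).const_mul _).fun_add ((hi 3).const_mul _)).fun_add
      ((hi 2).const_mul _)).fun_add ((hi 1).const_mul _)) ((hi 0).const_mul _),
    integral_add ((((hi 4).const_mul _).fun_add ((hi 3).const_mul _)).fun_add
      ((hi 2).const_mul _)) ((hi 1).const_mul _),
    integral_add (((hi 4).const_mul _).fun_add ((hi 3).const_mul _)) ((hi 2).const_mul _),
    integral_add ((hi 4).const_mul _) ((hi 3).const_mul _)]
  simp only [integral_const_mul]
  rw [integral_pow_stdNormal 4, integral_pow_stdNormal 3, integral_pow_stdNormal 2,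
    integral_pow_stdNormal 1, m1, m2, m3, m4]
  simp
  linarith

theorem abs_chiSqSummand_le (a b z : ℝ) (hab : a ^ 2 + b ^ 2 = 1) :
    |chiSqSummand a b z| ≤ 2 * (z ^ 2 + 1) := by
  have ha : |a| ≤ 1 := abs_le_one_iff_mul_self_le_one.2 (by nlinarith)
  have hb : |b| ≤ 1 := abs_le_one_iff_mul_self_le_one.2 (by nlinarith)
  have h2 : 1 ≤ √2 := Real.one_le_sqrt.2 (by norm_num)
  have h1 : |z ^ 2 - 1| ≤ z ^ 2 + 1 := by
    rw [abs_le]; constructor <;> nlinarith [sq_nonneg z]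
  have hz : |z| ≤ z ^ 2 + 1 := by nlinarith [sq_nonneg (|z| - 1), sq_abs z]
  unfold chiSqSummand
  calc |a * (z ^ 2 - 1) / √2 + b * z| ≤ |a| * |z ^ 2 - 1| / √2 + |b| * |z| := by
        refine (abs_add_le _ _).trans ?_
        rw [abs_div, abs_mul, abs_mul, abs_of_nonneg (Real.sqrt_nonneg 2)]
    _ ≤ 1 * (z ^ 2 + 1) / 1 + 1 * (z ^ 2 + 1) := by gcongr
    _ = 2 * (z ^ 2 + 1) := by ring

/-- `C` precedes `a` and `b`: this is the source of uniformity in `r`. -/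
theorem exists_norm_charFun_chiSqSummand_sub_le : ∃ C : ℝ, ∀ a b s : ℝ, a ^ 2 + b ^ 2 = 1 →
    ‖∫ z, Complex.exp ((s * chiSqSummand a b z : ℝ) * Complex.I) ∂gaussianReal 0 1
      - (1 - s ^ 2 / 2)‖ ≤ C * |s| ^ 3 := by
  refine ⟨4 * ∫ z, (2 * (z ^ 2 + 1)) ^ 3 ∂gaussianReal 0 1, fun a b s hab => ?_⟩
  have hB : Integrable (fun z : ℝ => (2 * (z ^ 2 + 1)) ^ 3) (gaussianReal 0 1) := by
    have hi := integrable_pow_stdNormal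
    have e : (fun z : ℝ => (2 * (z ^ 2 + 1)) ^ 3) =
        fun z => 8 * z ^ 6 + 24 * z ^ 4 + 24 * z ^ 2 + 8 * z ^ 0 := by
      funext z; ring
    rw [e]
    exact ((((hi 6).const_mul _).fun_add ((hi 4).const_mul _)).fun_add ((hi 2).const_mul _)).add
      ((hi 0).const_mul _)
  refine (norm_integral_exp_sub_le (continuous_chiSqSummand a b).aestronglyMeasurable
    (integrable_chiSqSummand a b) (integrable_chiSqSummand_sq a b) hB
    (fun z => pow_le_pow_left₀ (abs_nonneg _) (abs_chiSqSummand_le a b z hab) 3)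
    (integral_chiSqSummand a b) (integral_chiSqSummand_sq a b hab) s).trans_eq ?_
  ring

/-! ### The standard normal distribution function -/

theorem stdNormalCDF_sub_le {x y : ℝ} (h : x ≤ y) : stdNormalCDF y - stdNormalCDF x ≤ y - x := by
  have hm : (gaussianReal 0 1) (Set.Ioc x y) ≤ ENNReal.ofReal (y - x) := by
    rw [gaussianReal_apply _ one_ne_zero]
    calc ∫⁻ t in Set.Ioc x y, gaussianPDF 0 1 t ≤ ∫⁻ _ in Set.Ioc x y, 1 := by
          refine lintegral_mono fun t => ?_
          rw [gaussianPDF, ENNReal.ofReal_le_one, gaussianPDFReal]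
          -- The density is at most `1 / √(2π) ≤ 1`; the sharper constant is not needed.
          have h1 : 1 ≤ √(2 * Real.pi * (1 : NNReal)) := by
            rw [Real.one_le_sqrt]
            have := Real.pi_gt_three
            simp; linarith
          have h2 : Real.exp (-(t - 0) ^ 2 / (2 * (1 : NNReal))) ≤ 1 := by
            rw [Real.exp_le_one_iff]
            rw [neg_div, Left.neg_nonpos_iff]
            positivity
          calc _ ≤ (1 : ℝ) * 1 := by
                gcongr
                exact inv_le_one_of_one_le₀ h1
            _ = 1 := one_mul 1
      _ = ENNReal.ofReal (y - x) := by simp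
  rw [← measure_cdf (gaussianReal 0 1), StieltjesFunction.measure_Ioc] at hm
  exact (ENNReal.ofReal_le_ofReal_iff (by linarith)).1 hm

theorem monotone_stdNormalCDF : Monotone stdNormalCDF := monotone_cdf _

theorem lipschitzWith_stdNormalCDF : LipschitzWith 1 stdNormalCDF := by
  refine LipschitzWith.of_le_add fun x y => ?_
  rcases le_total x y with h | h
  · exact (monotone_stdNormalCDF h).trans (le_add_of_nonneg_right dist_nonneg)
  · have := stdNormalCDF_sub_le h
    rw [Real.dist_eq, abs_of_nonneg (by linarith)]
    linarith

theorem continuous_stdNormalCDF : Continuous stdNormalCDF := lipschitzWith_stdNormalCDF.continuous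

theorem strictMono_stdNormalCDF : StrictMono stdNormalCDF := by
  intro x y h
  have : (gaussianReal 0 1).IsOpenPosMeasure :=
    (gaussianReal_absolutelyContinuous' 0 one_ne_zero).isOpenPosMeasure
  have hpos : 0 < (gaussianReal 0 1) (Set.Ioc x y) :=
    ((isOpen_Ioo.measure_pos _ (Set.nonempty_Ioo.2 h))).trans_le
      (measure_mono Set.Ioo_subset_Ioc_self)
  rw [← measure_cdf (gaussianReal 0 1), StieltjesFunction.measure_Ioc, ENNReal.ofReal_pos] at hpos
  exact sub_pos.1 hpos

theorem exists_stdNormalCDF_eq {p : ℝ} (h0 : 0 < p) (h1 : p < 1) : ∃ x, stdNormalCDF x = p :=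
  mem_range_of_exists_le_of_exists_ge continuous_stdNormalCDF
    (((tendsto_cdf_atBot (gaussianReal 0 1)).eventually (gt_mem_nhds h0)).exists.imp
      fun _ h => le_of_lt h)
    (((tendsto_cdf_atTop (gaussianReal 0 1)).eventually (lt_mem_nhds h1)).exists.imp
      fun _ h => le_of_lt h)

theorem stdNormalCDF_mem_Icc (x : ℝ) : stdNormalCDF x ∈ Set.Icc (0 : ℝ) 1 :=
  ⟨cdf_nonneg _ _, cdf_le_one _ _⟩

theorem stdNormalCDF_quantile {p : ℝ} (h0 : 0 < p) (h1 : p < 1) :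
    stdNormalCDF (quantile (gaussianReal 0 1) p) = p := by
  obtain ⟨x, hx⟩ := exists_stdNormalCDF_eq h0 h1
  have hq := isLeast_quantile (gaussianReal 0 1) p h0 h1
  exact le_antisymm ((monotone_stdNormalCDF (hq.2 hx.ge)).trans hx.le) hq.1

theorem tendsto_of_tendsto_stdNormalCDF {ι : Type*} {l : Filter ι} {u : ι → ℝ} {z : ℝ}
    (h : Tendsto (fun i => stdNormalCDF (u i)) l (𝓝 (stdNormalCDF z))) : Tendsto u l (𝓝 z) := by
  refine tendsto_order.2 ⟨fun y hy => ?_, fun y hy => ?_⟩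
  · exact (h.eventually (lt_mem_nhds (strictMono_stdNormalCDF hy))).mono
      fun i hi => strictMono_stdNormalCDF.lt_iff_lt.1 hi
  · exact (h.eventually (gt_mem_nhds (strictMono_stdNormalCDF hy))).mono
      fun i hi => strictMono_stdNormalCDF.lt_iff_lt.1 hi

/-! ### From weak to uniform convergence of distribution functions -/

theorem tendsto_cdf_of_tendsto {ι : Type*} {l : Filter ι} {μ : ι → ProbabilityMeasure ℝ}
    {μ₀ : ProbabilityMeasure ℝ} (h : Tendsto μ l (𝓝 μ₀)) (x : ℝ) (hx : (μ₀ : Measure ℝ) {x} = 0) :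
    Tendsto (fun i => cdf (μ i) x) l (𝓝 (cdf μ₀ x)) := by
  have := ProbabilityMeasure.tendsto_measure_of_null_frontier_of_tendsto' h
    (E := Set.Iic x) (by rw [frontier_Iic]; exact hx)
  simp_rw [cdf_eq_real]
  exact (ENNReal.tendsto_toReal (measure_ne_top _ _)).comp this

/-- Pólya's theorem for the normal limit, along arbitrary evaluation points. -/
theorem tendsto_cdf_sub_stdNormalCDF {ι : Type*} {l : Filter ι} {F : ι → ℝ → ℝ}
    (hmono : ∀ i, Monotone (F i)) (h0 : ∀ i x, 0 ≤ F i x) (h1 : ∀ i x, F i x ≤ 1)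
    (h : ∀ x, Tendsto (fun i => F i x) l (𝓝 (stdNormalCDF x))) (x : ι → ℝ) :
    Tendsto (fun i => F i (x i) - stdNormalCDF (x i)) l (𝓝 0) := by
  -- Along an ultrafilter `Φ (x i)` converges to some `p` in `[0, 1]`, which treats finite and
  -- infinite limits of `x i` alike.
  rw [tendsto_iff_ultrafilter]
  intro U hU
  obtain ⟨p, hp, hpU⟩ := (isCompact_Icc (a := (0 : ℝ)) (b := 1)).ultrafilter_le_nhds
    (U.map fun i => stdNormalCDF (x i))
    (tendsto_principal.2 (Eventually.of_forall fun i => stdNormalCDF_mem_Icc (x i)))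
  have hxp : Tendsto (fun i => stdNormalCDF (x i)) U (𝓝 p) := hpU
  suffices hF : Tendsto (fun i => F i (x i)) U (𝓝 p) by simpa using hF.sub hxp
  refine tendsto_order.2 ⟨fun q hq => ?_, fun q hq => ?_⟩
  · rcases lt_or_ge q 0 with hq0 | hq0
    · exact Eventually.of_forall fun i => hq0.trans_le (h0 _ _)
    -- A fixed point `y` with `q < Φ y < p` separates: eventually `y < x i`, and monotonicity
    -- reduces to convergence at `y`.
    obtain ⟨y, hy⟩ := exists_stdNormalCDF_eq (p := (q + p) / 2) (by linarith)
      (by linarith [hp.2])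
    filter_upwards [hxp.eventually (lt_mem_nhds (show stdNormalCDF y < p by linarith)),
      ((h y).mono_left hU).eventually (lt_mem_nhds (show q < stdNormalCDF y by linarith))]
      with i hi hi'
    exact hi'.trans_le (hmono i (strictMono_stdNormalCDF.lt_iff_lt.1 hi).le)
  · rcases lt_or_ge 1 q with hq0 | hq0
    · exact Eventually.of_forall fun i => (h1 _ _).trans_lt hq0
    obtain ⟨y, hy⟩ := exists_stdNormalCDF_eq (p := (q + p) / 2) (by linarith [hp.1])
      (by linarith)
    filter_upwards [hxp.eventually (gt_mem_nhds (show p < stdNormalCDF y by linarith)),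
      ((h y).mono_left hU).eventually (gt_mem_nhds (show stdNormalCDF y < q by linarith))]
      with i hi hi'
    exact (hmono i (strictMono_stdNormalCDF.lt_iff_lt.1 hi).le).trans_lt hi'

theorem tendstoUniformly_zero_of_forall_tendsto {ι β : Type*} {l : Filter ι} {f : ι → β → ℝ}
    (h : ∀ u : ι → β, Tendsto (fun i => f i (u i)) l (𝓝 0)) :
    TendstoUniformly f (fun _ => 0) l := by
  rcases isEmpty_or_nonempty β with hβ | hβ
  · exact Metric.tendstoUniformly_iff.2 fun ε _ => Eventually.of_forall fun i x => hβ.elim x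
  rw [Metric.tendstoUniformly_iff]
  intro ε hε
  -- For each index, pick a point violating the bound `ε` if there is one.
  have hch : ∀ i, ∃ x, dist 0 (f i x) < ε → ∀ y, dist 0 (f i y) < ε := by
    intro i
    by_cases hy : ∀ y, dist 0 (f i y) < ε
    · exact ⟨Classical.arbitrary β, fun _ => hy⟩
    · push Not at hy
      obtain ⟨y, hy⟩ := hy
      exact ⟨y, fun hlt => absurd hlt hy.not_gt⟩
  choose u hu using hch
  filter_upwards [(h u).eventually (Metric.ball_mem_nhds 0 hε)] with i hi
  exact hu i (by rwa [dist_comm])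

/-! ### The standardized noncentral chi-squared law -/

/-- The law of `(X - d - r²) / √(2 d + 4 r²)` for `X` noncentral chi-squared with `d` degrees of
freedom and noncentrality parameter `r²`. -/
noncomputable def stdNoncentralChiSq (d : ℕ) (r : ℝ) : Measure ℝ :=
  (noncentralChiSq d (r ^ 2)).map fun x => (x - d - r ^ 2) / √(2 * d + 4 * r ^ 2)

instance (d : ℕ) (r : ℝ) : IsProbabilityMeasure (stdNoncentralChiSq d r) :=
  Measure.isProbabilityMeasure_map (Measurable.aemeasurable (by fun_prop))

theorem cdf_noncentralChiSq_eq {d : ℕ} (hd : 0 < d) (r x : ℝ) :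
    cdf (noncentralChiSq d (r ^ 2)) x =
      cdf (stdNoncentralChiSq d r) ((x - d - r ^ 2) / √(2 * d + 4 * r ^ 2)) := by
  have hσ : 0 < √(2 * d + 4 * r ^ 2) := Real.sqrt_pos.2 (by positivity)
  rw [cdf_eq_real, cdf_eq_real, stdNoncentralChiSq,
    map_measureReal_apply (by fun_prop) measurableSet_Iic]
  congr 1
  ext y
  simp [div_le_div_iff_of_pos_right hσ]

theorem sum_standardized_eq {d : ℕ} (hd : 0 < d) (r : ℝ) :
    ∃ a b : ℝ, a ^ 2 + b ^ 2 = 1 ∧ ∀ z : Fin d → ℝ,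
      (∑ i, (z i + √(r ^ 2 / d)) ^ 2 - d - r ^ 2) / √(2 * d + 4 * r ^ 2) =
        ∑ i, (√d)⁻¹ * chiSqSummand a b (z i) := by
  have hd' : (0 : ℝ) < d := by exact_mod_cast hd
  set m := √(r ^ 2 / d) with hm
  set σ := √(2 * d + 4 * r ^ 2) with hσ
  have hσ0 : 0 < σ := Real.sqrt_pos.2 (by positivity)
  have hσ2 : σ ^ 2 = 2 * d + 4 * r ^ 2 := Real.sq_sqrt (by positivity)
  have hm2 : d * m ^ 2 = r ^ 2 := by
    rw [hm, Real.sq_sqrt (by positivity)]; field_simp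
  have hs2 : √(d : ℝ) ^ 2 = d := Real.sq_sqrt hd'.le
  have hs0 : 0 < √(d : ℝ) := Real.sqrt_pos.2 hd'
  have h22 : √(2 : ℝ) ^ 2 = 2 := Real.sq_sqrt (by norm_num)
  have h20 : 0 < √(2 : ℝ) := Real.sqrt_pos.2 (by norm_num)
  -- Read off from `(z + m)² - 1 - m² = (z² - 1) + 2 m z`; the circle equation is `d (2 + 4 m²) =
  -- σ²`.
  refine ⟨√2 * √d / σ, 2 * m * √d / σ, ?_, fun z => ?_⟩
  · rw [div_pow, div_pow, ← add_div, div_eq_one_iff_eq (by positivity), hσ2, mul_pow, mul_pow,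
      mul_pow, hs2, h22]
    linear_combination 4 * hm2
  · have e : ∀ i, (√(d : ℝ))⁻¹ * chiSqSummand (√2 * √d / σ) (2 * m * √d / σ) (z i) =
        ((z i + m) ^ 2 - 1 - m ^ 2) / σ := by
      intro i
      unfold chiSqSummand
      field_simp
      ring
    simp_rw [e]
    rw [← Finset.sum_div, Finset.sum_sub_distrib, Finset.sum_sub_distrib]
    simp [hm2]

theorem charFun_stdNoncentralChiSq {d : ℕ} (hd : 0 < d) (r : ℝ) :
    ∃ a b : ℝ, a ^ 2 + b ^ 2 = 1 ∧ ∀ t : ℝ, charFun (stdNoncentralChiSq d r) t =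
      (∫ z, Complex.exp ((((√d)⁻¹ * t) * chiSqSummand a b z : ℝ) * Complex.I)
        ∂gaussianReal 0 1) ^ d := by
  obtain ⟨a, b, hab, h⟩ := sum_standardized_eq hd r
  refine ⟨a, b, hab, fun t => ?_⟩
  rw [charFun_apply_real, stdNoncentralChiSq, noncentralChiSq,
    Measure.map_map (by fun_prop) (by fun_prop),
    integral_map (Measurable.aemeasurable (by fun_prop)) (by fun_prop)]
  simp only [Function.comp, h]
  have hpow := integral_fintype_prod_eq_pow (ι := Fin d) (μ := gaussianReal 0 1)
    fun z => Complex.exp ((((√d)⁻¹ * t) * chiSqSummand a b z : ℝ) * Complex.I)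
  rw [Fintype.card_fin] at hpow
  rw [← hpow, stdNormalVec]
  congr 1
  funext z
  rw [← Complex.exp_sum]
  congr 1
  push_cast
  rw [Finset.mul_sum, Finset.sum_mul]
  refine Finset.sum_congr rfl fun i _ => ?_
  ring

theorem tendsto_charFun_stdNoncentralChiSq (r : ℕ → ℝ) (t : ℝ) :
    Tendsto (fun d => charFun (stdNoncentralChiSq d (r d)) t) atTop
      (𝓝 (charFun (gaussianReal 0 1) t)) := by
  have hex : ∀ d : ℕ, ∃ a b : ℝ, a ^ 2 + b ^ 2 = 1 ∧ (0 < d → ∀ t : ℝ,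
      charFun (stdNoncentralChiSq d (r d)) t =
        (∫ z, Complex.exp ((((√d)⁻¹ * t) * chiSqSummand a b z : ℝ) * Complex.I)
          ∂gaussianReal 0 1) ^ d) := by
    intro d
    rcases Nat.eq_zero_or_pos d with hd | hd
    -- At `d = 0` any point of the unit circle will do.
    · exact ⟨1, 0, by norm_num, fun h => absurd h hd.not_gt⟩
    · obtain ⟨a, b, hab, h⟩ := charFun_stdNoncentralChiSq hd (r d)
      exact ⟨a, b, hab, fun _ => h⟩
  choose a b hab hφ using hex
  obtain ⟨C, hC⟩ := exists_norm_charFun_chiSqSummand_sub_le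
  rw [charFun_gaussianReal]
  have hlim : Tendsto (fun d : ℕ => (∫ z, Complex.exp
      ((((√d)⁻¹ * t) * chiSqSummand (a d) (b d) z : ℝ) * Complex.I) ∂gaussianReal 0 1) ^ d)
      atTop (𝓝 (Complex.exp (-(t : ℂ) ^ 2 / 2))) := by
    refine Complex.tendsto_pow_exp_of_isLittleO_sub_add_div _ ?_
    have hO : (fun d : ℕ => (∫ z, Complex.exp
        ((((√d)⁻¹ * t) * chiSqSummand (a d) (b d) z : ℝ) * Complex.I) ∂gaussianReal 0 1)
        - (1 + (-(t : ℂ) ^ 2 / 2) / d)) =O[atTop] fun d : ℕ => (√d)⁻¹ * (1 / (d : ℝ)) := by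
      refine Asymptotics.IsBigO.of_bound (C * |t| ^ 3) (Eventually.of_forall fun d => ?_)
      have hd : (√(d : ℝ))⁻¹ ^ 2 = 1 / (d : ℝ) := by
        rw [inv_pow, Real.sq_sqrt (Nat.cast_nonneg d), one_div]
      have hdC : ((√(d : ℝ))⁻¹ : ℂ) ^ 2 = 1 / (d : ℂ) := by
        have := congrArg Complex.ofReal hd
        push_cast at this
        exact this
      have e : (1 + (-(t : ℂ) ^ 2 / 2) / d) = 1 - (((√d)⁻¹ * t : ℝ) : ℂ) ^ 2 / 2 := by
        push_cast
        rw [mul_pow, hdC]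
        ring
      rw [e]
      refine (hC (a d) (b d) _ (hab d)).trans_eq ?_
      rw [Real.norm_of_nonneg (by positivity), abs_mul, abs_of_nonneg (by positivity), ← hd]
      ring
    have ho : (fun d : ℕ => (√(d : ℝ))⁻¹ * (1 / (d : ℝ))) =o[atTop] fun d : ℕ => 1 / (d : ℂ) := by
      have h0 : (fun d : ℕ => (√(d : ℝ))⁻¹) =o[atTop] fun _ : ℕ => (1 : ℝ) :=
        (Asymptotics.isLittleO_one_iff ℝ).2
          (tendsto_inv_atTop_zero.comp (Real.tendsto_sqrt_atTop.comp tendsto_natCast_atTop_atTop))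
      have h1 := h0.mul_isBigO (Asymptotics.isBigO_refl (fun d : ℕ => 1 / (d : ℝ)) atTop)
      refine h1.trans_isBigO (Asymptotics.IsBigO.of_bound 1 (Eventually.of_forall fun d => ?_))
      simp
    exact hO.trans_isLittleO ho
  have e : Complex.exp (t * (0 : ℝ) * Complex.I - ((1 : NNReal) : ℝ) * t ^ 2 / 2) =
      Complex.exp (-(t : ℂ) ^ 2 / 2) := by
    congr 1
    simp
    ring
  rw [e]
  refine hlim.congr' ?_
  filter_upwards [eventually_gt_atTop 0] with d hd
  rw [hφ d hd t]

theorem tendsto_cdf_stdNoncentralChiSq (r : ℕ → ℝ) (x : ℝ) :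
    Tendsto (fun d => cdf (stdNoncentralChiSq d (r d)) x) atTop (𝓝 (stdNormalCDF x)) := by
  have hnull : NullSingletonClass (gaussianReal 0 1) :=
    nullSingletonClass_gaussianReal one_ne_zero
  have hx : gaussianReal 0 1 {x} = 0 := measure_singleton x
  exact tendsto_cdf_of_tendsto
    (μ := fun d => (⟨stdNoncentralChiSq d (r d), inferInstance⟩ : ProbabilityMeasure ℝ))
    (μ₀ := ⟨gaussianReal 0 1, inferInstance⟩)
    (ProbabilityMeasure.tendsto_of_tendsto_charFun fun t =>
      tendsto_charFun_stdNoncentralChiSq r t) x hx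

theorem tendsto_cdf_noncentralChiSq_sub (r x : ℕ → ℝ) :
    Tendsto (fun d : ℕ => cdf (noncentralChiSq d (r d ^ 2)) (x d)
      - stdNormalCDF ((x d - d - r d ^ 2) / √(2 * d + 4 * r d ^ 2))) atTop (𝓝 0) := by
  refine (tendsto_cdf_sub_stdNormalCDF (F := fun d => cdf (stdNoncentralChiSq d (r d)))
    (fun d => monotone_cdf _) (fun d => cdf_nonneg _) (fun d => cdf_le_one _)
    (tendsto_cdf_stdNoncentralChiSq r)
    fun d => (x d - d - r d ^ 2) / √(2 * d + 4 * r d ^ 2)).congr' ?_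
  filter_upwards [eventually_gt_atTop 0] with d hd
  rw [cdf_noncentralChiSq_eq hd]

theorem tendsto_cdf_centralChiSq_sub (x : ℕ → ℝ) :
    Tendsto (fun d : ℕ => cdf (centralChiSq d) (x d) - stdNormalCDF ((x d - d) / √(2 * d)))
      atTop (𝓝 0) := by
  simpa [noncentralChiSq_zero] using tendsto_cdf_noncentralChiSq_sub (fun _ => 0) x

/-! ### Quantiles -/

theorem tendsto_standardized_quantile_centralChiSq {p : ℝ} (h0 : 0 < p) (h1 : p < 1) :
    Tendsto (fun d : ℕ => (quantile (centralChiSq d) p - d) / √(2 * d)) atTop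
      (𝓝 (quantile (gaussianReal 0 1) p)) := by
  refine tendsto_of_tendsto_stdNormalCDF ?_
  rw [stdNormalCDF_quantile h0 h1]
  have hq := fun d => isLeast_quantile (centralChiSq d) p h0 h1
  have hright := tendsto_cdf_centralChiSq_sub fun d => quantile (centralChiSq d) p
  -- The distribution function is at least `p` at the quantile and below `p` one unit to the left.
  -- In standardized scale that unit is `1 / √(2d) → 0`, so continuity of the chi-squared
  -- distribution function is not needed.
  have hleft := tendsto_cdf_centralChiSq_sub fun d => quantile (centralChiSq d) p - 1
  have hshift : Tendsto (fun d : ℕ => 1 / √(2 * d : ℝ)) atTop (𝓝 0) := by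
    simp only [one_div]
    exact tendsto_inv_atTop_zero.comp (Real.tendsto_sqrt_atTop.comp
      (tendsto_natCast_atTop_atTop.const_mul_atTop two_pos))
  have hlt : ∀ d, cdf (centralChiSq d) (quantile (centralChiSq d) p - 1) < p := by
    intro d
    by_contra h
    have := (hq d).2 (not_lt.1 h)
    linarith
  refine tendsto_order.2 ⟨fun y hy => ?_, fun y hy => ?_⟩
  · filter_upwards [hright.eventually (gt_mem_nhds (sub_pos.2 hy))] with d hd
    have : p ≤ cdf (centralChiSq d) (quantile (centralChiSq d) p) := (hq d).1
    linarith
  · have hsum := hshift.sub hleft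
    rw [sub_zero] at hsum
    filter_upwards [hsum.eventually (gt_mem_nhds (sub_pos.2 hy))] with d hd
    have hlip : stdNormalCDF ((quantile (centralChiSq d) p - d) / √(2 * d)) -
        stdNormalCDF ((quantile (centralChiSq d) p - 1 - d) / √(2 * d)) ≤ 1 / √(2 * d) := by
      refine (stdNormalCDF_sub_le ?_).trans_eq ?_
      · gcongr; linarith
      · ring
    linarith [hlt d]

theorem abs_sqrt_div_sqrt_le_one (d : ℕ) (r : ℝ) :
    |√(2 * d) / √(2 * d + 4 * r ^ 2)| ≤ 1 := by
  rw [abs_of_nonneg (by positivity)]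
  refine div_le_one_of_le₀ (Real.sqrt_le_sqrt ?_) (Real.sqrt_nonneg _)
  nlinarith [sq_nonneg r]

theorem tendsto_cdf_noncentralChiSq_quantile_sub {p : ℝ} (h0 : 0 < p) (h1 : p < 1) (r : ℕ → ℝ) :
    Tendsto (fun d : ℕ => cdf (noncentralChiSq d (r d ^ 2)) (quantile (centralChiSq d) p)
      - stdNormalCDF (√(2 * d) / √(2 * d + 4 * r d ^ 2) * quantile (gaussianReal 0 1) p
          - r d ^ 2 / √(2 * d + 4 * r d ^ 2))) atTop (𝓝 0) := by
  have hmain := tendsto_cdf_noncentralChiSq_sub r fun d => quantile (centralChiSq d) p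
  have hz := tendsto_iff_dist_tendsto_zero.1 (tendsto_standardized_quantile_centralChiSq h0 h1)
  have hdiff : Tendsto (fun d : ℕ =>
      stdNormalCDF ((quantile (centralChiSq d) p - d - r d ^ 2) / √(2 * d + 4 * r d ^ 2))
      - stdNormalCDF (√(2 * d) / √(2 * d + 4 * r d ^ 2) * quantile (gaussianReal 0 1) p
          - r d ^ 2 / √(2 * d + 4 * r d ^ 2))) atTop (𝓝 0) := by
    refine squeeze_zero_norm' ?_ hz
    filter_upwards [eventually_gt_atTop 0] with d hd
    rw [← dist_eq_norm]
    refine (lipschitzWith_stdNormalCDF.dist_le_mul _ _).trans ?_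
    have hs : √(2 * d : ℝ) ≠ 0 := (Real.sqrt_pos.2 (by positivity)).ne'
    -- The `r²` terms cancel, leaving the quantile error times a factor at most 1.
    have e : (quantile (centralChiSq d) p - d - r d ^ 2) / √(2 * d + 4 * r d ^ 2) -
        (√(2 * d) / √(2 * d + 4 * r d ^ 2) * quantile (gaussianReal 0 1) p
          - r d ^ 2 / √(2 * d + 4 * r d ^ 2)) =
        √(2 * d) / √(2 * d + 4 * r d ^ 2) *
          ((quantile (centralChiSq d) p - d) / √(2 * d) - quantile (gaussianReal 0 1) p) := by
      field_simp
      ring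
    rw [NNReal.coe_one, one_mul, Real.dist_eq, Real.dist_eq, e, abs_mul]
    exact mul_le_of_le_one_left (abs_nonneg _) (abs_sqrt_div_sqrt_le_one d (r d))
  simpa using hmain.add hdiff

theorem mainTheorem4 :
    TendstoUniformly
      (fun (d : ℕ) (x : ℝ) =>
        cdf (centralChiSq d) x - stdNormalCDF ((x - d) / √(2 * d)))
      (fun _ => 0) atTop ∧
    TendstoUniformly
      (fun (d : ℕ) (q : ℝ × ℝ) =>
        cdf (noncentralChiSq d (q.2 ^ 2)) q.1
          - stdNormalCDF ((q.1 - d - q.2 ^ 2) / √(2 * d + 4 * q.2 ^ 2)))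
      (fun _ => 0) atTop ∧
    ∀ α : ℝ, 0 < α → α < 1 →
      TendstoUniformly
        (fun (d : ℕ) (r : ℝ) =>
          cdf (noncentralChiSq d (r ^ 2)) (quantile (centralChiSq d) (1 - α))
            - stdNormalCDF
                (√(2 * d) / √(2 * d + 4 * r ^ 2) * quantile (gaussianReal 0 1) (1 - α)
                  - r ^ 2 / √(2 * d + 4 * r ^ 2)))
        (fun _ => 0) atTop := by
  refine ⟨tendstoUniformly_zero_of_forall_tendsto tendsto_cdf_centralChiSq_sub,
    tendstoUniformly_zero_of_forall_tendsto fun q =>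
      tendsto_cdf_noncentralChiSq_sub (fun d => (q d).2) fun d => (q d).1,
    fun α h0 h1 => tendstoUniformly_zero_of_forall_tendsto fun r =>
      tendsto_cdf_noncentralChiSq_quantile_sub (by linarith) (by linarith) r⟩
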